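/- There is a universal constant $C>0$ such that the following holds. For all $0<c_1<C_1$ there exists $c_2>0$ such that the following is true. Let $n\in\mathbb{N}$ and let $|\cdot|_\sharp$ be a norm on $\mathbb{R}^n$ that is invariant under coordinate permutations and satisfies $c_1|x|_\infty\le |x|_\sharp\le C_1|x|_\infty$ for all $x\in\mathbb{R}^n$, where $|x|_\infty=\max_i|x_i|$. Let $\varepsilon\in(0,1)$ and let $k$ be an integer with $$0<k\le c_2\,\varepsilon\left(\ln \varepsilon^{-1}\right)^{-1}\ln n\qquad\text{and}\qquad k\le c_2\ln n$$ (the second condition follows from the first when $\varepsilon\le 1/2$). Let $G$ be an $n\times k$ random matrix whose entries are independent standard normal random variables, let $e_1$ be the first standard basis vector of $\mathbb{R}^k$, let $\mathbb{M}|Ge_1|_\sharp$ be the median of $|Ge_1|_\sharp$, and let $|\cdot|$ be the Euclidean norm on $\mathbb{R}^k$. Then with probability at least $1-Cn^{-c_2\varepsilon}$, for all $x\in\mathbb{R}^k$, $$(1-\varepsilon)\,\mathbb{M}|Ge_1|_\sharp\,|x|\le |Gx|_\sharp\le(1+\varepsilon)\,\mathbb{M}|Ge_1|_\sharp\,|x|.$$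 -/

import Mathlib

open MeasureTheory ProbabilityTheory

/-- `G` is (on the probability space `(Ω, μ)`) an `n × k` standard Gaussian random matrix:
its entries are independent random variables with the standard normal distribution. -/
structure IsStdGaussianMatrix {Ω : Type*} [MeasurableSpace Ω] (μ : Measure Ω) {n k : ℕ}
    (G : Ω → Matrix (Fin n) (Fin k) ℝ) : Prop where
  hasLaw_entry : ∀ i j, HasLaw (fun ω => G ω i j) (gaussianReal 0 1) μ
  indep_entries : iIndepFun (fun (p : Fin n × Fin k) (ω : Ω) => G ω p.1 p.2) μ

/-- `m` is a median of the real random variable `X` on the probability space `(Ω, μ)`. -/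
def IsMedian {Ω : Type*} [MeasurableSpace Ω] (μ : Measure Ω) (X : Ω → ℝ) (m : ℝ) : Prop :=
  1 / 2 ≤ μ.real {ω | X ω ≤ m} ∧ 1 / 2 ≤ μ.real {ω | m ≤ X ω}

/-! A permutation invariant norm depends only on the sorted vector, and the sorted coordinates of a
Gaussian vector are very rigid. The number of coordinates above `t` has mean `n * gaussTail t`, and
moving `t` by `δ` shrinks this mean by at least the factor `exp (-(t * δ) - δ ^ 2 / 2)`
(`gaussTail_add_le`). Take `δ = η ε √(log n)`. Where the mean is at least `y = n ^ (η ε / 8)`,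
Chebyshev's inequality separates the counts at `t` and `t + δ` by a deterministic level. Where it is
smaller, `t` is of order `√(log n)`, the mean at `t + δ` is at most `1 / y`, and probably no
coordinate lies that high. Both failures are polynomially small in `1 / y` and `1 / ε`
(`exists_interlaced_levels`).

Two vectors separated by the same levels, together with their negatives, have sorted versions within
`2 * δ` in the maximum norm, so their norms differ by at most `2 * C₁ * δ`
(`Interlaced.seminorm_sub_le`). The median is at least `c₁ √(log n) / 4`, so for small `η` this is a
relative error `ε / 4`.

Every unit direction `x` gives a Gaussian vector `G x`. A union bound over an `ε / 8`-net of at most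
`(17 / ε) ^ k` points costs `n ^ O(c₂ ε)` under the hypotheses on `k`, which the single-direction
bound absorbs. Convexity extends the estimate from the net to all vectors. -/

/-! ### Nets of the sphere and approximation from a net -/

/-- A finite subset of the unit sphere that is `ρ`-separated has at most `(1 + 2 / ρ) ^ dim`
elements. -/
theorem card_le_of_separated_sphere {E : Type*} [NormedAddCommGroup E] [NormedSpace ℝ E]
    [FiniteDimensional ℝ E] {ρ : ℝ} (hρ : 0 < ρ) (s : Finset E) (hs : ∀ c ∈ s, ‖c‖ = 1)
    (h : ∀ c ∈ s, ∀ d ∈ s, c ≠ d → ρ ≤ ‖c - d‖) :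
    (s.card : ℝ) ≤ (1 + 2 / ρ) ^ Module.finrank ℝ E := by
  borelize E
  let μ : Measure E := Measure.addHaar
  have hδ : 0 < ρ / 2 := by positivity
  have hR : 0 < 1 + ρ / 2 := by positivity
  set A := ⋃ c ∈ s, Metric.ball (c : E) (ρ / 2) with hA
  have D : Set.Pairwise (s : Set E)
      (Function.onFun Disjoint fun c => Metric.ball (c : E) (ρ / 2)) := by
    rintro c hc d hd hcd
    apply Metric.ball_disjoint_ball
    rw [dist_eq_norm, add_halves]
    exact h c hc d hd hcd
  have A_subset : A ⊆ Metric.ball (0 : E) (1 + ρ / 2) := by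
    refine Set.iUnion₂_subset fun x hx => ?_
    apply Metric.ball_subset_ball'
    rw [dist_zero_right, hs x hx, add_comm]
  have I : (s.card : ENNReal) * ENNReal.ofReal ((ρ / 2) ^ Module.finrank ℝ E)
      * μ (Metric.ball 0 1) ≤
      ENNReal.ofReal ((1 + ρ / 2) ^ Module.finrank ℝ E) * μ (Metric.ball 0 1) :=
    calc
      _ = μ A := by
        rw [hA, measure_biUnion_finset D fun c _ => measurableSet_ball]
        simp only [μ.addHaar_ball_of_pos _ hδ, Finset.sum_const, nsmul_eq_mul, mul_assoc]
      _ ≤ μ (Metric.ball (0 : E) (1 + ρ / 2)) := measure_mono A_subset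
      _ = _ := by simp only [μ.addHaar_ball_of_pos _ hR]
  have J := (ENNReal.mul_le_mul_iff_left (Metric.measure_ball_pos μ (0 : E) zero_lt_one).ne'
    measure_ball_lt_top.ne).1 I
  have K := ENNReal.toReal_le_of_le_ofReal (by positivity) J
  rw [ENNReal.toReal_mul, ENNReal.toReal_natCast, ENNReal.toReal_ofReal (by positivity)] at K
  rw [show (1 + 2 / ρ) = (1 + ρ / 2) / (ρ / 2) by field_simp; ring, div_pow,
    le_div_iff₀ (by positivity)]
  exact K

/-- The unit sphere has a `ρ`-net with at most `(1 + 2 / ρ) ^ dim` elements. -/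
theorem exists_sphere_net (E : Type*) [NormedAddCommGroup E] [NormedSpace ℝ E]
    [FiniteDimensional ℝ E] {ρ : ℝ} (hρ : 0 < ρ) :
    ∃ s : Finset E, (∀ c ∈ s, ‖c‖ = 1) ∧ (∀ x : E, ‖x‖ = 1 → ∃ c ∈ s, ‖x - c‖ < ρ) ∧
      (s.card : ℝ) ≤ (1 + 2 / ρ) ^ Module.finrank ℝ E := by
  classical
  let P : Finset E → Prop := fun s => (∀ c ∈ s, ‖c‖ = 1) ∧
    ∀ c ∈ s, ∀ d ∈ s, c ≠ d → ρ ≤ ‖c - d‖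
  have hbdd : BddAbove {N | ∃ s, P s ∧ s.card = N} := by
    refine ⟨⌈(1 + 2 / ρ) ^ Module.finrank ℝ E⌉₊, ?_⟩
    rintro _ ⟨s, hs, rfl⟩
    exact_mod_cast (card_le_of_separated_sphere hρ s hs.1 hs.2).trans (Nat.le_ceil _)
  -- A separated set of maximal cardinality is a net, since a point far from it could be added.
  obtain ⟨s, hs, hcard⟩ := Nat.sSup_mem (s := {N | ∃ s, P s ∧ s.card = N})
    ⟨0, ∅, by simp [P], rfl⟩ hbdd
  refine ⟨s, hs.1, fun x hx => ?_, card_le_of_separated_sphere hρ s hs.1 hs.2⟩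
  by_contra! hfar
  have hxs : x ∉ s := fun hmem => by simpa [hρ.not_ge] using hfar x hmem
  have hP : P (insert x s) := by
    refine ⟨fun c hc => ?_, fun c hc d hd hcd => ?_⟩
    · rcases Finset.mem_insert.1 hc with rfl | hc
      exacts [hx, hs.1 c hc]
    · rcases Finset.mem_insert.1 hc with rfl | hc' <;> rcases Finset.mem_insert.1 hd with rfl | hd'
      · exact absurd rfl hcd
      · exact hfar d hd'
      · rw [norm_sub_rev]; exact hfar c hc'
      · exact hs.2 c hc' d hd' hcd
  have := le_csSup hbdd ⟨_, hP, rfl⟩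
  rw [Finset.card_insert_of_notMem hxs, ← hcard] at this
  omega

/-- If a seminorm is nearly constant on a net of the unit sphere, it is nearly Euclidean. -/
theorem Seminorm.almost_isometric_of_net {E : Type*} [NormedAddCommGroup E] [NormedSpace ℝ E]
    [FiniteDimensional ℝ E] (q : Seminorm ℝ E) (hq : Continuous q) {ε M : ℝ}
    (hε : 0 < ε) (hε1 : ε < 1) (hM : 0 ≤ M) (s : Finset E)
    (hnet : ∀ x : E, ‖x‖ = 1 → ∃ c ∈ s, ‖x - c‖ < ε / 8)
    (hval : ∀ c ∈ s, |q c - M| ≤ ε / 4 * M) (x : E) :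
    (1 - ε) * M * ‖x‖ ≤ q x ∧ q x ≤ (1 + ε) * M * ‖x‖ := by
  rcases eq_or_ne x 0 with rfl | hx
  · simp
  have hx0 : 0 < ‖x‖ := norm_pos_iff.2 hx
  have hunit : ∀ z : E, z ≠ 0 → ‖(‖z‖⁻¹ • z)‖ = 1 := fun z hz => by
    rw [norm_smul, norm_inv, norm_norm, inv_mul_cancel₀ (norm_ne_zero_iff.2 hz)]
  have hscale : ∀ z : E, z ≠ 0 → q z = ‖z‖ * q (‖z‖⁻¹ • z) := fun z hz => by
    rw [map_smul_eq_mul, norm_inv, norm_norm, mul_inv_cancel_left₀ (norm_ne_zero_iff.2 hz)]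
  have : ProperSpace E := FiniteDimensional.proper_real E
  obtain ⟨x₀, hx₀, hmax⟩ := (isCompact_sphere (0 : E) 1).exists_isMaxOn
    ⟨_, mem_sphere_zero_iff_norm.2 (hunit x hx)⟩ hq.continuousOn
  have hx₀ : ‖x₀‖ = 1 := mem_sphere_zero_iff_norm.1 hx₀
  have hS : ∀ z : E, q z ≤ ‖z‖ * q x₀ := fun z => by
    rcases eq_or_ne z 0 with rfl | hz
    · simp
    · rw [hscale z hz]
      exact mul_le_mul_of_nonneg_left (hmax (mem_sphere_zero_iff_norm.2 (hunit z hz)))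
        (norm_nonneg _)
  have hq0 : 0 ≤ q x₀ := apply_nonneg q _
  -- The maximum over the sphere bounds itself: `q x₀ ≤ (ε / 8) * q x₀ + (1 + ε / 4) * M`, and `1 +
  -- ε / 4 ≤ (1 - ε / 8) * (1 + ε)`.
  have hub : q x₀ ≤ (1 + ε) * M := by
    obtain ⟨c, hc, hcx⟩ := hnet x₀ hx₀
    have h1 : q x₀ ≤ q (x₀ - c) + q c := by simpa using map_add_le_add q (x₀ - c) c
    have h2 := hS (x₀ - c)
    have h3 := (abs_le.1 (hval c hc)).2
    have h4 : ‖x₀ - c‖ * q x₀ ≤ ε / 8 * q x₀ := mul_le_mul_of_nonneg_right hcx.le hq0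
    have h5 : (1 - ε / 8) * q x₀ ≤ (1 - ε / 8) * ((1 + ε) * M) := by
      nlinarith [mul_nonneg hε.le hM, mul_nonneg (mul_nonneg hε.le (sub_nonneg.2 hε1.le)) hM]
    exact le_of_mul_le_mul_left h5 (by linarith)
  rw [hscale x hx]
  set z := ‖x‖⁻¹ • x
  have hz : ‖z‖ = 1 := hunit x hx
  have hzS := hS z
  rw [hz, one_mul] at hzS
  constructor
  · obtain ⟨c, hc, hcz⟩ := hnet z hz
    have h1 : q c ≤ q (c - z) + q z := by simpa using map_add_le_add q (c - z) z
    have h2 := hS (c - z)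
    rw [norm_sub_rev] at h2
    have h3 := (abs_le.1 (hval c hc)).1
    have h4 : ‖z - c‖ * q x₀ ≤ ε / 8 * ((1 + ε) * M) :=
      mul_le_mul hcz.le hub hq0 (by linarith)
    rw [mul_comm]
    refine mul_le_mul_of_nonneg_left ?_ hx0.le
    nlinarith [mul_nonneg hε.le hM, mul_nonneg (mul_nonneg hε.le (sub_nonneg.2 hε1.le)) hM]
  · rw [mul_comm]
    exact mul_le_mul_of_nonneg_right (hzS.trans hub) hx0.le

/-! ### Gaussian tails -/

/-- The probability that a standard normal variable is at least `t`. -/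
noncomputable def gaussTail (t : ℝ) : ℝ := (gaussianReal 0 1).real (Set.Ici t)

theorem gaussTail_nonneg (t : ℝ) : 0 ≤ gaussTail t := measureReal_nonneg

theorem gaussTail_le_one (t : ℝ) : gaussTail t ≤ 1 := measureReal_le_one

theorem gaussTail_eq_integral (t : ℝ) :
    gaussTail t = ∫ x in Set.Ici t, gaussianPDFReal 0 1 x := by
  rw [gaussTail, measureReal_def, gaussianReal_apply_eq_integral 0 one_ne_zero,
    ENNReal.toReal_ofReal]
  exact integral_nonneg fun x => gaussianPDFReal_nonneg 0 1 x

/-- After translating by `δ`, the densities compare pointwise on `x ≥ t`, because `(x + δ) ^ 2 ≥ x ^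
2 + 2 * t * δ + δ ^ 2`. -/
theorem gaussTail_add_le (t : ℝ) {δ : ℝ} (hδ : 0 ≤ δ) :
    gaussTail (t + δ) ≤ Real.exp (-(t * δ) - δ ^ 2 / 2) * gaussTail t := by
  have hshift : gaussTail (t + δ) = ∫ x in Set.Ici t, gaussianPDFReal 0 1 (x + δ) := by
    have h := (measurePreserving_add_right (volume : Measure ℝ) δ).setIntegral_preimage_emb
      (measurableEmbedding_addRight δ) (gaussianPDFReal 0 1) (Set.Ici (t + δ))
    rw [gaussTail_eq_integral, ← h]
    congr 2
    ext x
    simp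
  rw [hshift, gaussTail_eq_integral, ← integral_const_mul]
  have hint := integrable_gaussianPDFReal 0 1
  refine setIntegral_mono_on (hint.comp_add_right δ).integrableOn
    (hint.const_mul _).integrableOn measurableSet_Ici fun x hx => ?_
  have hx : t ≤ x := hx
  simp only [gaussianPDFReal, sub_zero, NNReal.coe_one, mul_one]
  rw [mul_left_comm, ← Real.exp_add]
  refine mul_le_mul_of_nonneg_left (Real.exp_le_exp.2 ?_) (by positivity)
  nlinarith [mul_le_mul_of_nonneg_right hx hδ]

theorem gaussTail_antitone : Antitone gaussTail := fun _ _ h =>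
  measureReal_mono (Set.Ici_subset_Ici.2 h)

theorem gaussTail_le_exp {t : ℝ} (ht : 0 ≤ t) : gaussTail t ≤ Real.exp (-(t ^ 2) / 2) := by
  have h := gaussTail_add_le 0 ht
  rw [zero_add, zero_mul, neg_zero, zero_sub, ← neg_div] at h
  exact h.trans (mul_le_of_le_one_right (Real.exp_pos _).le (gaussTail_le_one 0))

theorem exp_le_gaussTail {t : ℝ} (ht : 0 ≤ t) :
    Real.exp (-(t + 1) ^ 2 / 2 - 1) ≤ gaussTail t := by
  -- Equivalent to `2 * π ≤ e ^ 2`.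
  have hsqrt : Real.exp (-1) ≤ (Real.sqrt (2 * Real.pi))⁻¹ := by
    rw [Real.exp_neg]
    refine inv_anti₀ (by positivity) ?_
    rw [Real.sqrt_le_left (Real.exp_pos _).le]
    nlinarith [Real.exp_one_gt_d9, Real.pi_lt_d2]
  have hint := integrable_gaussianPDFReal 0 1
  calc Real.exp (-(t + 1) ^ 2 / 2 - 1)
      = ∫ _ in Set.Icc t (t + 1), Real.exp (-(t + 1) ^ 2 / 2 - 1) := by simp
    _ ≤ ∫ x in Set.Icc t (t + 1), gaussianPDFReal 0 1 x := by
        refine setIntegral_mono_on (by simp) hint.integrableOn measurableSet_Icc fun x hx => ?_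
        simp only [gaussianPDFReal, sub_zero, NNReal.coe_one, mul_one]
        rw [sub_eq_add_neg, Real.exp_add, mul_comm]
        refine mul_le_mul hsqrt (Real.exp_le_exp.2 ?_) (Real.exp_pos _).le (by positivity)
        have := mul_self_le_mul_self (ht.trans hx.1) hx.2
        nlinarith
    _ ≤ gaussTail t := by
        rw [gaussTail_eq_integral]
        exact setIntegral_mono_set hint.integrableOn
          (Filter.Eventually.of_forall fun x => gaussianPDFReal_nonneg 0 1 x)
          (Set.Icc_subset_Ici_self).eventuallyLE

/-! ### Counting functions and sorted vectors -/

/-- The number of coordinates of `x` that are at least `t`. -/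
noncomputable def countGE {n : ℕ} (x : Fin n → ℝ) (t : ℝ) : ℕ :=
  (Finset.univ.filter fun i => t ≤ x i).card

theorem countGE_comp_perm {n : ℕ} (x : Fin n → ℝ) (σ : Equiv.Perm (Fin n)) (t : ℝ) :
    countGE (x ∘ σ) t = countGE x t := by
  unfold countGE
  refine Finset.card_bij (fun i _ => σ i) (fun i hi => by simpa using hi)
    (fun i _ j _ h => σ.injective h) fun j hj => ⟨σ.symm j, by simpa using hj, by simp⟩

theorem one_le_countGE {n : ℕ} {x : Fin n → ℝ} {t : ℝ} {i : Fin n} (h : t ≤ x i) :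
    1 ≤ countGE x t :=
  Finset.card_pos.2 ⟨i, by simpa using h⟩

theorem le_of_monotone_of_countGE_le {n : ℕ} {x y : Fin n → ℝ} (hx : Monotone x)
    (hy : Monotone y) {s t : ℝ} (h : countGE x t ≤ countGE y s) {i : Fin n} (hi : t ≤ x i) :
    s ≤ y i := by
  by_contra! hlt
  -- By monotonicity, at least `n - i` coordinates of `x` reach `t`, while `y i < s` leaves at most
  -- `n - i - 1` coordinates of `y` to reach `s`.
  have h1 : (Finset.Ici i).card ≤ countGE x t :=
    Finset.card_le_card fun j hj => by simpa using hi.trans (hx (Finset.mem_Ici.1 hj))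
  have h2 : countGE y s ≤ (Finset.Ioi i).card :=
    Finset.card_le_card fun j hj => by
      rw [Finset.mem_Ioi]
      by_contra! hji
      exact absurd (hlt.trans_le (by simpa using hj)) (hy hji).not_gt
  rw [Fin.card_Ici] at h1
  rw [Fin.card_Ioi] at h2
  omega

/-- On the grid `0, δ, …, (m + 1) δ` the counting function of `x` is separated by the
levels `a`. -/
def Interlaced {n : ℕ} (a : ℕ → ℝ) (δ : ℝ) (m : ℕ) (x : Fin n → ℝ) : Prop :=
  ∀ j ≤ m, (countGE x (j * δ + δ) : ℝ) ≤ a j ∧ a j ≤ countGE x (j * δ)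

theorem Interlaced.comp_perm {n : ℕ} {a : ℕ → ℝ} {δ : ℝ} {m : ℕ} {x : Fin n → ℝ}
    (h : Interlaced a δ m x) (σ : Equiv.Perm (Fin n)) : Interlaced a δ m (x ∘ σ) := fun j hj => by
  simpa only [countGE_comp_perm] using h j hj

/-- If `x i` lies in `[(j + 1) * δ, (j + 2) * δ)`, the level `a j` forces `y` to have at least as
many coordinates above `j * δ` as `x` has above `(j + 1) * δ`, hence `y i ≥ j * δ`. The condition `a
m = 0` rules out values beyond the grid. -/
theorem Interlaced.sub_le {n : ℕ} {a : ℕ → ℝ} {δ : ℝ} (hδ : 0 < δ) {m : ℕ} (ha : a m = 0)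
    {x y : Fin n → ℝ} (hx : Interlaced a δ m x) (hy : Interlaced a δ m y) (hxm : Monotone x)
    (hym : Monotone y) {i : Fin n} (hi : δ ≤ x i) : x i - 2 * δ ≤ y i := by
  obtain ⟨j, hj⟩ : ∃ j, ⌊x i / δ⌋₊ = j + 1 :=
    Nat.exists_eq_succ_of_ne_zero (Nat.floor_pos.2 ((one_le_div hδ).2 hi)).ne'
  have h1 : ((j : ℝ) + 1) * δ ≤ x i := by
    have := Nat.floor_le (div_nonneg (hδ.le.trans hi) hδ.le)
    rw [hj, le_div_iff₀ hδ] at this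
    exact_mod_cast this
  have h2 : x i < ((j : ℝ) + 2) * δ := by
    have := Nat.lt_floor_add_one (x i / δ)
    rw [hj, div_lt_iff₀ hδ] at this
    push_cast at this
    linarith
  rcases le_or_gt j m with hjm | hjm
  · have hcount : countGE x (j * δ + δ) ≤ countGE y (j * δ) := by
      exact_mod_cast (hx j hjm).1.trans (hy j hjm).2
    have := le_of_monotone_of_countGE_le hxm hym hcount (i := i) (by linarith)
    linarith
  · have hle : (m : ℝ) * δ + δ ≤ x i := by
      have : (m : ℝ) ≤ j := by exact_mod_cast hjm.le
      nlinarith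
    have h0 := (hx m le_rfl).1
    rw [ha] at h0
    have h3 : (1 : ℝ) ≤ countGE x (m * δ + δ) := by exact_mod_cast one_le_countGE hle
    linarith

theorem Interlaced.abs_sub_le {n : ℕ} {a : ℕ → ℝ} {δ : ℝ} (hδ : 0 < δ) {m : ℕ} (ha : a m = 0)
    {x y : Fin n → ℝ} (hx : Interlaced a δ m x) (hx' : Interlaced a δ m (-x))
    (hy : Interlaced a δ m y) (hy' : Interlaced a δ m (-y)) (hxm : Monotone x)
    (hym : Monotone y) (i : Fin n) : |x i - y i| ≤ 2 * δ := by
  have key : ∀ {x y : Fin n → ℝ}, Interlaced a δ m x → Interlaced a δ m (-x) →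
      Interlaced a δ m y → Interlaced a δ m (-y) → Monotone x → Monotone y →
      x i - 2 * δ ≤ y i := by
    intro x y hx hx' hy hy' hxm hym
    by_cases h1 : δ ≤ x i
    · exact hx.sub_le hδ ha hy hxm hym h1
    -- Very negative values are handled by negating, which reverses the order, hence `Fin.revPerm`.
    -- In the remaining case `x i < δ` and `-δ < y i`, which already suffices.
    by_cases h2 : δ ≤ -y i
    · have hmono : ∀ {z : Fin n → ℝ}, Monotone z → Monotone ((-z) ∘ Fin.revPerm) :=
        fun hz k l hkl => neg_le_neg (hz (Fin.rev_le_rev.2 hkl))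
      have := (hy'.comp_perm Fin.revPerm).sub_le hδ ha (hx'.comp_perm Fin.revPerm) (hmono hym)
        (hmono hxm) (i := Fin.rev i) (by simpa using h2)
      simp at this
      linarith
    · linarith
  have h1 := key hx hx' hy hy' hxm hym
  have h2 := key hy hy' hx hx' hym hxm
  exact abs_le.2 ⟨by linarith, by linarith⟩

/-- A permutation invariant seminorm dominated by the maximum norm varies little among vectors
whose counting functions are separated by the same levels. -/
theorem Interlaced.seminorm_sub_le {n : ℕ} (N : Seminorm ℝ (Fin n → ℝ))
    (hN : ∀ (σ : Equiv.Perm (Fin n)) (x : Fin n → ℝ), N (x ∘ σ) = N x) {B : ℝ} (hB : 0 ≤ B)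
    (hNB : ∀ x, N x ≤ B * ‖x‖) {a : ℕ → ℝ} {δ : ℝ} (hδ : 0 < δ) {m : ℕ} (ha : a m = 0)
    {x y : Fin n → ℝ} (hx : Interlaced a δ m x) (hx' : Interlaced a δ m (-x))
    (hy : Interlaced a δ m y) (hy' : Interlaced a δ m (-y)) : N x - N y ≤ B * (2 * δ) := by
  rw [← hN (Tuple.sort x) x, ← hN (Tuple.sort y) y]
  refine ((le_abs_self _).trans (abs_sub_map_le_sub N _ _)).trans ((hNB _).trans ?_)
  refine mul_le_mul_of_nonneg_left ((pi_norm_le_iff_of_nonneg (by positivity)).2 fun i => ?_) hB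
  exact abs_sub_le hδ ha (hx.comp_perm _) (hx'.comp_perm (Tuple.sort x)) (hy.comp_perm _)
    (hy'.comp_perm (Tuple.sort y)) (Tuple.monotone_sort x) (Tuple.monotone_sort y) i

/-! ### Concentration of the counting function -/

/-- `X` is a vector of pairwise independent standard normal random variables. -/
structure IsStdGaussianVector {Ω : Type*} [MeasurableSpace Ω] (μ : Measure Ω) {n : ℕ}
    (X : Ω → Fin n → ℝ) : Prop where
  hasLaw : ∀ i, HasLaw (fun ω => X ω i) (gaussianReal 0 1) μ
  indep : Pairwise fun i j => IndepFun (fun ω => X ω i) (fun ω => X ω j) μ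

section

variable {Ω : Type*} [MeasurableSpace Ω] {μ : Measure Ω} {n : ℕ} {X : Ω → Fin n → ℝ}

theorem IsStdGaussianVector.neg (hX : IsStdGaussianVector μ X) :
    IsStdGaussianVector μ fun ω => -X ω where
  hasLaw i := by
    have := gaussianReal_neg (hX.hasLaw i)
    rw [neg_zero] at this
    exact this
  indep i j hij := (hX.indep hij).comp measurable_neg measurable_neg

theorem IsStdGaussianVector.measureReal_le_coord (hX : IsStdGaussianVector μ X) (i : Fin n)
    (t : ℝ) : μ.real {ω | t ≤ X ω i} = gaussTail t :=
  (hX.hasLaw i).measureReal_eq (p := fun x => t ≤ x) measurableSet_Ici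

variable [IsProbabilityMeasure μ]

theorem IsStdGaussianVector.measureReal_countGE_pos_le (hX : IsStdGaussianVector μ X) (t : ℝ) :
    μ.real {ω | 0 < countGE (X ω) t} ≤ n * gaussTail t := by
  have hsub : {ω | 0 < countGE (X ω) t} ⊆ ⋃ i, {ω | t ≤ X ω i} := fun ω hω => by
    obtain ⟨i, hi⟩ := Finset.card_pos.1 (show 0 < countGE (X ω) t from hω)
    exact Set.mem_iUnion.2 ⟨i, by simpa using hi⟩
  refine (measureReal_mono hsub).trans ((measureReal_iUnion_fintype_le _).trans ?_)
  simp [hX.measureReal_le_coord]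

/-- The count is a sum of indicators, each with variance at most its mean. Only second moments
enter, so pairwise independence is enough. -/
theorem IsStdGaussianVector.chebyshev_countGE (hX : IsStdGaussianVector μ X) (t : ℝ) {s : ℝ}
    (hs : 0 < s) :
    μ.real {ω | s ≤ |(countGE (X ω) t : ℝ) - n * gaussTail t|} ≤ n * gaussTail t / s ^ 2 := by
  let f : ℝ → ℝ := (Set.Ici t).indicator 1
  have hf : Measurable f := measurable_one.indicator measurableSet_Ici
  have hfb : ∀ x, ‖f x‖ ≤ 1 := fun x => by
    by_cases h : x ∈ Set.Ici t <;> simp [f, h]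
  let Y : Fin n → Ω → ℝ := fun i ω => f (X ω i)
  have hYmeas : ∀ i, AEStronglyMeasurable (Y i) μ := fun i =>
    (hf.comp_aemeasurable (hX.hasLaw i).aemeasurable).aestronglyMeasurable
  have hYL : ∀ i, MemLp (Y i) 2 μ := fun i =>
    MemLp.of_bound (hYmeas i) 1 (Filter.Eventually.of_forall fun ω => hfb _)
  have hYmean : ∀ i, ∫ ω, Y i ω ∂μ = gaussTail t := fun i => by
    have := (hX.hasLaw i).integral_comp (f := f) hf.aestronglyMeasurable
    rw [show (∫ ω, Y i ω ∂μ) = ∫ ω, (f ∘ fun ω => X ω i) ω ∂μ from rfl, this,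
      integral_indicator_one measurableSet_Ici, gaussTail]
  have hYvar : ∀ i, variance (Y i) μ ≤ gaussTail t := fun i => by
    refine (variance_le_expectation_sq (hYmeas i)).trans (le_of_eq ?_)
    rw [← hYmean i]
    refine integral_congr_ae (Filter.Eventually.of_forall fun ω => ?_)
    by_cases h : X ω i ∈ Set.Ici t <;> simp [Y, f, h]
  have hcount : ∀ ω, (countGE (X ω) t : ℝ) = (∑ i, Y i) ω := fun ω => by
    simp [countGE, Y, f, Set.indicator_apply, Finset.sum_boole]
  have hsum : ∫ ω, (∑ i, Y i) ω ∂μ = n * gaussTail t := by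
    simp only [Finset.sum_apply]
    rw [integral_finsetSum _ fun i _ => (hYL i).integrable one_le_two]
    simp [hYmean]
  have hvar : variance (∑ i, Y i) μ ≤ n * gaussTail t := by
    rw [IndepFun.variance_sum (fun i _ => hYL i)
      fun i _ j _ hij => (hX.indep hij).comp hf hf]
    exact (Finset.sum_le_sum fun i _ => hYvar i).trans (by simp)
  have hcheb := meas_ge_le_variance_div_sq (memLp_finsetSum' Finset.univ fun i _ => hYL i) hs
    (μ := μ)
  rw [hsum] at hcheb
  simp only [hcount]
  refine (ENNReal.toReal_le_of_le_ofReal ?_ hcheb).trans ?_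
  · exact div_nonneg (variance_nonneg _ _) (sq_nonneg s)
  · gcongr

/-- A level separating, with high probability, the number of coordinates above `t + δ` from the
number of coordinates above `t`. -/
noncomputable def sepLevel (n : ℕ) (δ y t : ℝ) : ℝ :=
  open Classical in
  if y ≤ n * gaussTail t then n * (gaussTail t + gaussTail (t + δ)) / 2 else 0

theorem IsStdGaussianVector.measureReal_not_separated_le (hX : IsStdGaussianVector μ X)
    {δ y t : ℝ} (hδ : 0 < δ) (hy : 0 < y) (ht : 0 ≤ t)
    (hgap : n * gaussTail t < y → n * gaussTail (t + δ) ≤ 1 / y) :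
    μ.real {ω | ¬ ((countGE (X ω) (t + δ) : ℝ) ≤ sepLevel n δ y t ∧
      sepLevel n δ y t ≤ countGE (X ω) t)} ≤ 8 / (y * (1 - Real.exp (-δ ^ 2 / 2)) ^ 2) := by
  set θ := 1 - Real.exp (-δ ^ 2 / 2) with hθ
  have hθ0 : 0 < θ := sub_pos.2 (by
    rw [← Real.exp_zero]
    exact Real.exp_lt_exp.2 (by nlinarith [sq_pos_of_pos hδ]))
  have hθ1 : θ ≤ 1 := sub_le_self _ (Real.exp_pos _).le
  by_cases hcase : y ≤ n * gaussTail t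
  · set P := (n : ℝ) * gaussTail t with hP
    set Q := (n : ℝ) * gaussTail (t + δ) with hQ
    have hlevel : sepLevel n δ y t = (P + Q) / 2 := by
      rw [sepLevel, if_pos hcase, hP, hQ]; ring
    have hPpos : 0 < P := hy.trans_le hcase
    have hQP : Q ≤ (1 - θ) * P := by
      have h1 : gaussTail (t + δ) ≤ (1 - θ) * gaussTail t := by
        refine (gaussTail_add_le t hδ.le).trans
          (mul_le_mul_of_nonneg_right ?_ (gaussTail_nonneg t))
        rw [hθ, sub_sub_cancel]
        exact Real.exp_le_exp.2 (by nlinarith [mul_nonneg ht hδ.le])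
      calc Q ≤ n * ((1 - θ) * gaussTail t) := mul_le_mul_of_nonneg_left h1 n.cast_nonneg
        _ = (1 - θ) * P := by rw [hP]; ring
    -- Since `P - Q ≥ θ * P`, the midpoint level is at distance at least `P * θ / 2` from both
    -- means.
    have hs : 0 < P * θ / 2 := by positivity
    have hsub : {ω | ¬ ((countGE (X ω) (t + δ) : ℝ) ≤ sepLevel n δ y t ∧
        sepLevel n δ y t ≤ countGE (X ω) t)} ⊆
        {ω | P * θ / 2 ≤ |(countGE (X ω) (t + δ) : ℝ) - Q|} ∪
        {ω | P * θ / 2 ≤ |(countGE (X ω) t : ℝ) - P|} := by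
      intro ω hω
      rw [hlevel] at hω
      by_contra hnot
      simp only [Set.mem_union, Set.mem_ofPred_eq, not_or, not_le, abs_lt] at hnot
      exact hω ⟨by linarith [hnot.1.2], by linarith [hnot.2.1]⟩
    have hbound : ∀ {R : ℝ}, R ≤ P → R / (P * θ / 2) ^ 2 ≤ 4 / (y * θ ^ 2) := fun {R} hR => by
      calc R / (P * θ / 2) ^ 2 ≤ P / (P * θ / 2) ^ 2 := by gcongr
        _ = 4 / (P * θ ^ 2) := by field_simp; ring
        _ ≤ 4 / (y * θ ^ 2) := by gcongr
    calc _ ≤ _ := measureReal_mono hsub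
      _ ≤ _ := measureReal_union_le _ _
      _ ≤ 4 / (y * θ ^ 2) + 4 / (y * θ ^ 2) :=
        add_le_add ((hX.chebyshev_countGE (t + δ) hs).trans
          (hbound (hQP.trans (mul_le_of_le_one_left hPpos.le (by linarith)))))
          ((hX.chebyshev_countGE t hs).trans (hbound le_rfl))
      _ = 8 / (y * θ ^ 2) := by ring
  · have hlevel : sepLevel n δ y t = 0 := if_neg hcase
    have hsub : {ω | ¬ ((countGE (X ω) (t + δ) : ℝ) ≤ sepLevel n δ y t ∧
        sepLevel n δ y t ≤ countGE (X ω) t)} ⊆ {ω | 0 < countGE (X ω) (t + δ)} := by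
      intro ω hω
      rw [hlevel] at hω
      by_contra hnot
      simp only [Set.mem_ofPred_eq, not_lt, nonpos_iff_eq_zero] at hnot
      exact hω ⟨by rw [hnot, Nat.cast_zero], Nat.cast_nonneg _⟩
    calc _ ≤ _ := measureReal_mono hsub
      _ ≤ _ := hX.measureReal_countGE_pos_le _
      _ ≤ 1 / y := hgap (not_le.1 hcase)
      _ ≤ 8 / (y * θ ^ 2) := by
        rw [div_le_div_iff₀ hy (by positivity)]
        nlinarith [mul_le_mul_of_nonneg_left (pow_le_one₀ hθ0.le hθ1 (n := 2)) hy.le]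

theorem IsStdGaussianVector.measureReal_not_interlaced_le (hX : IsStdGaussianVector μ X)
    {δ y : ℝ} (hδ : 0 < δ) (hy : 0 < y) (m : ℕ)
    (hgap : ∀ t, 0 ≤ t → n * gaussTail t < y → n * gaussTail (t + δ) ≤ 1 / y) :
    μ.real {ω | ¬ Interlaced (fun j => sepLevel n δ y (j * δ)) δ m (X ω)} ≤
      (m + 1) * (8 / (y * (1 - Real.exp (-δ ^ 2 / 2)) ^ 2)) := by
  have hsub : {ω | ¬ Interlaced (fun j => sepLevel n δ y (j * δ)) δ m (X ω)} ⊆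
      ⋃ j ∈ Finset.range (m + 1), {ω | ¬ ((countGE (X ω) (j * δ + δ) : ℝ) ≤
        sepLevel n δ y (j * δ) ∧ sepLevel n δ y (j * δ) ≤ countGE (X ω) (j * δ))} := by
    intro ω hω
    simp only [Interlaced, Set.mem_ofPred_eq, not_forall] at hω
    obtain ⟨j, hj, h⟩ := hω
    exact Set.mem_iUnion₂.2 ⟨j, Finset.mem_range_succ_iff.2 hj, h⟩
  refine (measureReal_mono hsub (measure_ne_top _ _)).trans
    ((measureReal_biUnion_finset_le _ _).trans ?_)
  refine (Finset.sum_le_card_nsmul _ _ _ fun j _ =>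
    hX.measureReal_not_separated_le hδ hy (by positivity) (hgap _ (by positivity))).trans ?_
  simp

end

/-! ### Gaussian matrices applied to unit vectors, and medians -/

section

variable {Ω : Type*} [MeasurableSpace Ω] {μ : Measure Ω}

/-- A linear combination of independent standard normal variables whose coefficient vector is a
unit vector is standard normal. -/
theorem hasLaw_gaussianReal_sum_mul [IsProbabilityMeasure μ] {k : ℕ} {Y : Fin k → Ω → ℝ}
    (hlaw : ∀ j, HasLaw (Y j) (gaussianReal 0 1) μ) (hind : iIndepFun Y μ) {x : Fin k → ℝ}
    (hx : ∑ j, x j ^ 2 = 1) :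
    HasLaw (fun ω => ∑ j, Y j ω * x j) (gaussianReal 0 1) μ := by
  let Z : Fin k → Ω → ℝ := fun j ω => Y j ω * x j
  have hZind : iIndepFun Z μ :=
    hind.comp (fun j a => a * x j) fun j => measurable_id.mul_const _
  have hYg : ∀ j, HasGaussianLaw (Y j) μ := fun j =>
    ⟨by rw [(hlaw j).map_eq]; infer_instance⟩
  have hZlaw : ∀ j, HasLaw (Z j) (gaussianReal (x j * 0) (.mk (x j ^ 2) (sq_nonneg _) * 1)) μ :=
    fun j => gaussianReal_mul_const (hlaw j) (x j)
  have hZg : ∀ j, HasGaussianLaw (Z j) μ := fun j => ⟨by rw [(hZlaw j).map_eq]; infer_instance⟩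
  have hZL : ∀ j, MemLp (Z j) 2 μ := fun j => (hZg j).memLp_two
  have hsum := hZind.hasGaussianLaw_sum hZg
  have hmean : ∫ ω, (∑ j, Z j) ω ∂μ = 0 := by
    simp only [Finset.sum_apply]
    rw [integral_finsetSum _ fun j _ => (hZL j).integrable one_le_two]
    refine Finset.sum_eq_zero fun j _ => ?_
    rw [(hZlaw j).integral_eq, integral_id_gaussianReal, mul_zero]
  have hvar : variance (∑ j, Z j) μ = 1 := by
    rw [IndepFun.variance_sum (fun j _ => hZL j) fun i _ j _ hij => hZind.indepFun hij, ← hx]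
    refine Finset.sum_congr rfl fun j _ => ?_
    rw [(hZlaw j).variance_eq, variance_id_gaussianReal]
    simp
  have hmap := hsum.map_eq_gaussianReal
  rw [hmean, hvar, Real.toNNReal_one] at hmap
  have hfun : (fun ω => ∑ j, Y j ω * x j) = ∑ j, Z j := by
    ext ω
    simp [Z]
  rw [hfun]
  exact ⟨hsum.aemeasurable, hmap⟩

theorem IsStdGaussianMatrix.mulVec [IsProbabilityMeasure μ] {n k : ℕ}
    {G : Ω → Matrix (Fin n) (Fin k) ℝ} (hG : IsStdGaussianMatrix μ G) {x : Fin k → ℝ}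
    (hx : ∑ j, x j ^ 2 = 1) : IsStdGaussianVector μ fun ω => (G ω).mulVec x where
  hasLaw i := hasLaw_gaussianReal_sum_mul (fun j => hG.hasLaw_entry i j)
    (hG.indep_entries.precomp (g := fun j => (i, j)) fun _ _ h => (Prod.mk.inj h).2) hx
  indep i i' hii := by
    classical
    let S : Fin n → Finset (Fin n × Fin k) := fun i => Finset.univ.filter fun p => p.1 = i
    have hS : ∀ i j, (i, j) ∈ S i := fun i j => by simp [S]
    have hdisj : Disjoint (S i) (S i') := Finset.disjoint_filter.2 fun p _ h h' =>
      hii (h.symm.trans h')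
    have hind := hG.indep_entries.indepFun_finset₀ (S i) (S i') hdisj fun p =>
      (hG.hasLaw_entry p.1 p.2).aemeasurable
    let φ : ∀ i, (S i → ℝ) → ℝ := fun i v => ∑ j, v ⟨(i, j), hS i j⟩ * x j
    have hφ : ∀ i, Measurable (φ i) := fun i => by fun_prop
    exact hind.comp (hφ i) (hφ i')

theorem one_sub_le_measureReal_of_compl_subset [IsProbabilityMeasure μ] {A B : Set Ω}
    (h : Aᶜ ⊆ B) : 1 - μ.real B ≤ μ.real A := by
  have h1 : μ.real (A ∪ Aᶜ) ≤ μ.real A + μ.real Aᶜ := measureReal_union_le _ _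
  rw [Set.union_compl_self, probReal_univ] at h1
  linarith [measureReal_mono h (μ := μ)]

/-- With its companion for `≥`, this places the median between two values taken outside an unlikely
event, so that closeness of such values to one another becomes closeness to the median. -/
theorem IsMedian.exists_notMem_le [IsFiniteMeasure μ] {Z : Ω → ℝ} {M : ℝ} (hM : IsMedian μ Z M)
    {B : Set Ω} (hB : μ.real B < 1 / 2) : ∃ ω, ω ∉ B ∧ Z ω ≤ M := by
  by_contra! h
  have : {ω | Z ω ≤ M} ⊆ B := fun ω hω => by_contra fun hn => (h ω hn).not_ge hω
  linarith [measureReal_mono this (μ := μ), hM.1]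

theorem IsMedian.exists_notMem_ge [IsFiniteMeasure μ] {Z : Ω → ℝ} {M : ℝ} (hM : IsMedian μ Z M)
    {B : Set Ω} (hB : μ.real B < 1 / 2) : ∃ ω, ω ∉ B ∧ M ≤ Z ω := by
  by_contra! h
  have : {ω | M ≤ Z ω} ⊆ B := fun ω hω => by_contra fun hn => (h ω hn).not_ge hω
  linarith [measureReal_mono this (μ := μ), hM.2]

end

/-! ### Choice of scales and lower bound for the median -/

/-- With `s = √(log n)`, the inequality `(s / 4 + 1) ^ 2 / 2 ≤ s ^ 2 / 16 + 1` costs only `n ^ (1 /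
16)` in the tail. -/
theorem exp_le_mul_gaussTail {n : ℕ} (hn : 0 < n) :
    Real.exp (15 / 16 * Real.log n - 2) ≤ n * gaussTail (√(Real.log n) / 4) := by
  have hn0 : (0 : ℝ) < n := by exact_mod_cast hn
  have hs := Real.sq_sqrt (Real.log_natCast_nonneg n)
  set s := √(Real.log n)
  calc Real.exp (15 / 16 * Real.log n - 2)
      ≤ Real.exp (Real.log n + (-(s / 4 + 1) ^ 2 / 2 - 1)) :=
        Real.exp_le_exp.2 (by nlinarith [sq_nonneg (s / 4 - 1)])
    _ = n * Real.exp (-(s / 4 + 1) ^ 2 / 2 - 1) := by rw [Real.exp_add, Real.exp_log hn0]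
    _ ≤ n * gaussTail (s / 4) := mul_le_mul_of_nonneg_left
        (exp_le_gaussTail (div_nonneg (Real.sqrt_nonneg _) (by norm_num))) hn0.le

/-- The failure probability of the separation events, uniformly in the norm. -/
theorem exists_interlaced_levels {n : ℕ} {η ε : ℝ} (hη : 0 < η) (hη1 : η ≤ 1) (hε : 0 < ε)
    (hε1 : ε < 1) (hL : 5 ≤ ε * Real.log n) :
    ∃ (a : ℕ → ℝ) (m : ℕ), a m = 0 ∧
      ∀ {Ω : Type*} [MeasurableSpace Ω] (μ : Measure Ω) [IsProbabilityMeasure μ]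
        (X : Ω → Fin n → ℝ), IsStdGaussianVector μ X →
        μ.real {ω | ¬ (Interlaced a (η * ε * √(Real.log n)) m (X ω) ∧
          Interlaced a (η * ε * √(Real.log n)) m (-X ω))} ≤
        576 / η ^ 5 * (ε⁻¹) ^ 3 * Real.exp (-(η / 8 * (ε * Real.log n))) := by
  set l := Real.log n with hl
  have hl0 : 0 ≤ l := Real.log_natCast_nonneg n
  have hl5 : 5 ≤ l := by nlinarith
  have hn : 0 < n := by
    rcases Nat.eq_zero_or_pos n with rfl | h
    · simp [hl] at hl5; linarith
    · exact h
  have hn0 : (0 : ℝ) < n := by exact_mod_cast hn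
  have hs : √l ^ 2 = l := Real.sq_sqrt hl0
  set s := √l with hsdef
  have hs0 : 0 < s := Real.sqrt_pos.2 (by linarith)
  set δ := η * ε * s with hδdef
  have hδ : 0 < δ := by positivity
  set L := ε * l with hLdef
  have hLl : L ≤ l := by nlinarith
  set y := Real.exp (η / 8 * L) with hydef
  have hy : 0 < y := Real.exp_pos _
  have hy1 : 1 < y := Real.one_lt_exp_iff.2 (by positivity)
  -- The last index `m` has `m * δ ≥ 2 * √(log n)`, where the expected count is at most `n * n ^
  -- (-2) ≤ 1 < y`, so its level is zero.
  set m := ⌈2 / (η * ε)⌉₊ with hm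
  have hηε : η * ε ≤ 1 := mul_le_one₀ hη1 hε.le hε1.le
  have hηε0 : 0 < η * ε := by positivity
  refine ⟨fun j => sepLevel n δ y (j * δ), m, ?_, fun {Ω} _ μ _ X hX => ?_⟩
  · refine if_neg (not_le.2 (lt_of_le_of_lt ?_ hy1))
    have hmδ : 2 * s ≤ m * δ := by
      have h1 : 2 ≤ m * (η * ε) := (div_le_iff₀ hηε0).1 (Nat.le_ceil _)
      rw [hδdef, ← mul_assoc]
      exact mul_le_mul_of_nonneg_right h1 hs0.le
    calc (n : ℝ) * gaussTail (m * δ) ≤ n * Real.exp (-((2 * s) ^ 2) / 2) :=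
          mul_le_mul_of_nonneg_left ((gaussTail_antitone hmδ).trans
            (gaussTail_le_exp (by positivity))) hn0.le
      _ = Real.exp (l + -((2 * s) ^ 2) / 2) := by rw [Real.exp_add, hl, Real.exp_log hn0]
      _ ≤ 1 := Real.exp_le_one_iff.2 (by nlinarith)
  · have hgap : ∀ t, 0 ≤ t → n * gaussTail t < y → n * gaussTail (t + δ) ≤ 1 / y := by
      intro t ht hty
      -- Below `s / 4` the expected count is at least `exp (15 / 16 * l - 2)`, which is at least
      -- `y`.
      have hst : s / 4 ≤ t := by
        by_contra! hlt
        have h1 := exp_le_mul_gaussTail hn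
        rw [← hl, ← hsdef] at h1
        have h2 : y ≤ Real.exp (15 / 16 * l - 2) := Real.exp_le_exp.2 (by nlinarith)
        have h3 := mul_le_mul_of_nonneg_left (gaussTail_antitone hlt.le) hn0.le
        linarith
      -- The shift gains a factor `y ^ (-2)`, turning a mean below `y` into one at most `1 / y`.
      have htδ : η / 8 * L * 2 ≤ t * δ := by
        have : s / 4 * δ ≤ t * δ := mul_le_mul_of_nonneg_right hst hδ.le
        refine le_trans (le_of_eq ?_) this
        rw [hδdef, hLdef, ← hs]; ring
      calc (n : ℝ) * gaussTail (t + δ)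
          ≤ n * (Real.exp (-(η / 8 * L * 2)) * gaussTail t) := by
            refine mul_le_mul_of_nonneg_left ((gaussTail_add_le t hδ.le).trans ?_) hn0.le
            refine mul_le_mul_of_nonneg_right (Real.exp_le_exp.2 ?_) (gaussTail_nonneg t)
            nlinarith [sq_nonneg δ]
        _ = Real.exp (-(η / 8 * L * 2)) * (n * gaussTail t) := by ring
        _ ≤ Real.exp (-(η / 8 * L * 2)) * y :=
            mul_le_mul_of_nonneg_left hty.le (Real.exp_pos _).le
        _ = 1 / y := by
            rw [hydef, ← Real.exp_add, one_div, ← Real.exp_neg]; congr 1; ring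
    have hbad := hX.measureReal_not_interlaced_le hδ hy m hgap
    have hbad' := hX.neg.measureReal_not_interlaced_le hδ hy m hgap
    have hmle : (m : ℝ) + 1 ≤ 4 / (η * ε) := by
      have h1 := (Nat.ceil_lt_add_one (show 0 ≤ 2 / (η * ε) by positivity)).le
      have h2 : 1 ≤ 1 / (η * ε) := (one_le_div hηε0).2 hηε
      calc (m : ℝ) + 1 ≤ 2 / (η * ε) + 1 + 1 := by linarith
        _ ≤ 2 / (η * ε) + 1 / (η * ε) + 1 / (η * ε) := by linarith
        _ = 4 / (η * ε) := by ring
    have hθ : η ^ 2 * ε / 3 ≤ 1 - Real.exp (-δ ^ 2 / 2) := by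
      set u := η ^ 2 * ε / 2 with hu
      have hu0 : 0 ≤ u := by positivity
      have hu1 : u ≤ 1 / 2 := by nlinarith
      have hδu : u ≤ δ ^ 2 / 2 := by
        have : δ ^ 2 / 2 = u * L := by rw [hδdef, hu, hLdef, ← hs]; ring
        rw [this]
        nlinarith
      have h1 : Real.exp (-δ ^ 2 / 2) ≤ (1 + u)⁻¹ := by
        rw [show -δ ^ 2 / 2 = -(δ ^ 2 / 2) by ring, Real.exp_neg]
        refine inv_anti₀ (by positivity) ?_
        linarith [Real.add_one_le_exp (δ ^ 2 / 2)]
      have h2 : (1 + u)⁻¹ ≤ 1 - 2 / 3 * u := by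
        rw [inv_le_iff_one_le_mul₀ (by positivity)]
        nlinarith
      linarith
    have hterm : (m + 1) * (8 / (y * (1 - Real.exp (-δ ^ 2 / 2)) ^ 2)) ≤
        288 / η ^ 5 * (ε⁻¹) ^ 3 * Real.exp (-(η / 8 * L)) := by
      calc (m + 1) * (8 / (y * (1 - Real.exp (-δ ^ 2 / 2)) ^ 2))
          ≤ 4 / (η * ε) * (8 / (y * (η ^ 2 * ε / 3) ^ 2)) := by gcongr
        _ = 288 / η ^ 5 * (ε⁻¹) ^ 3 * Real.exp (-(η / 8 * L)) := by
            rw [Real.exp_neg, ← hydef]; field_simp; norm_num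
    have hsub : {ω | ¬ (Interlaced (fun j => sepLevel n δ y (j * δ)) δ m (X ω) ∧
        Interlaced (fun j => sepLevel n δ y (j * δ)) δ m (-X ω))} ⊆
        {ω | ¬ Interlaced (fun j => sepLevel n δ y (j * δ)) δ m (X ω)} ∪
        {ω | ¬ Interlaced (fun j => sepLevel n δ y (j * δ)) δ m (-X ω)} := fun ω hω =>
      not_and_or.1 hω
    calc _ ≤ _ := measureReal_mono hsub
      _ ≤ _ := measureReal_union_le _ _
      _ ≤ _ := add_le_add (hbad.trans hterm) (hbad'.trans hterm)
      _ = _ := by ring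

/-- The median of a norm bounded below by a multiple of the maximum norm is at least of order
`√(log n)`. -/
theorem IsStdGaussianVector.le_median {Ω : Type*} [MeasurableSpace Ω] {μ : Measure Ω}
    [IsProbabilityMeasure μ] {n : ℕ} {X : Ω → Fin n → ℝ} (hX : IsStdGaussianVector μ X)
    {N : (Fin n → ℝ) → ℝ} {b : ℝ} (hb : 0 < b) (hN : ∀ x, b * ‖x‖ ≤ N x)
    (hn : 5 ≤ Real.log n) {M : ℝ} (hM : IsMedian μ (fun ω => N (X ω)) M) :
    b * (√(Real.log n) / 4) ≤ M := by
  have hn0 : 0 < n := by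
    rcases Nat.eq_zero_or_pos n with rfl | h
    · simp at hn; linarith
    · exact h
  set t := √(Real.log n) / 4
  set P := (n : ℝ) * gaussTail t with hP
  have hP2 : 2 < P := by
    refine lt_of_lt_of_le ?_ (exp_le_mul_gaussTail hn0)
    refine lt_of_lt_of_le ?_ (Real.exp_le_exp.2 (show 1 ≤ 15 / 16 * Real.log n - 2 by linarith))
    linarith [Real.exp_one_gt_d9]
  -- Deviation `P` includes the event that no coordinate reaches `t`; its probability is at most `1
  -- / P < 1 / 2`.
  have hcheb := hX.chebyshev_countGE t (show 0 < P by linarith)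
  obtain ⟨ω, hω, hωM⟩ := hM.exists_notMem_le (lt_of_le_of_lt hcheb (by
    rw [← hP, div_lt_iff₀ (by positivity)]
    nlinarith))
  have hpos : 0 < countGE (X ω) t := by
    rw [Nat.pos_iff_ne_zero]
    intro h0
    apply hω
    simp only [Set.mem_ofPred_eq, h0, ← hP, Nat.cast_zero, zero_sub, abs_neg]
    exact le_abs_self _
  obtain ⟨i, hi⟩ := Finset.card_pos.1 hpos
  have hti : t ≤ X ω i := by simpa using hi
  have hnorm : t ≤ ‖X ω‖ := hti.trans ((le_abs_self _).trans (norm_le_pi_norm (X ω) i))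
  exact (mul_le_mul_of_nonneg_left hnorm hb.le).trans ((hN _).trans hωM)

/-! ### Union bound over the net and conclusion -/

/-- In the exponent, `k * log 17`, `k * log ε⁻¹`, `3 * log ε⁻¹` and `log K` are at most `6 * c₂ *
L`, `c₂ * L`, `3 * c₂ * L` and `c * L / 2`. The sum with `-(c * L)` is at most `-(c₂ * L)` once `11
* c₂ ≤ c / 2`. -/
theorem net_card_mul_failure_le {k : ℕ} (hk : 0 < k) {ε K c c₂ L : ℝ} (hε : 0 < ε)
    (hε1 : ε < 1) (hK : 1 ≤ K) (hc₂ : 0 < c₂) (hc : 22 * c₂ ≤ c)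
    (hcK : 4 * c₂ * Real.log K ≤ c) (hkL : (k : ℝ) ≤ 2 * c₂ * L)
    (hkε : k * Real.log ε⁻¹ ≤ c₂ * L) :
    (17 / ε) ^ k * (K * (ε⁻¹) ^ 3 * Real.exp (-(c * L))) ≤ Real.exp (-(c₂ * L)) := by
  have hk1 : (1 : ℝ) ≤ k := by exact_mod_cast hk
  have hlogε : 0 < Real.log ε⁻¹ := Real.log_pos (one_lt_inv_iff₀.2 ⟨hε, hε1⟩)
  have hlogK : 0 ≤ Real.log K := Real.log_nonneg hK
  have hL : 0 ≤ L := by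
    by_contra! hneg
    nlinarith
  have h17 : Real.log 17 ≤ 3 := by
    rw [Real.log_le_iff_le_exp (by norm_num), show (3 : ℝ) = 1 + 1 + 1 by norm_num,
      Real.exp_add, Real.exp_add]
    have h := Real.exp_one_gt_d9
    nlinarith [mul_self_le_mul_self (by norm_num) h.le]
  have hpow : (17 / ε) ^ k = Real.exp (k * Real.log 17 + k * Real.log ε⁻¹) := by
    rw [← mul_add, ← Real.log_mul (by norm_num) (inv_ne_zero hε.ne'), ← Real.log_pow,
      Real.exp_log (by positivity), div_eq_mul_inv]
  have hinv : (ε⁻¹) ^ 3 = Real.exp (3 * Real.log ε⁻¹) := by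
    have := Real.exp_log (pow_pos (inv_pos.2 hε) 3)
    rw [Real.log_pow] at this
    exact_mod_cast this.symm
  have hKe : K = Real.exp (Real.log K) := (Real.exp_log (by linarith)).symm
  have hlogεL : Real.log ε⁻¹ ≤ c₂ * L := (le_mul_of_one_le_left hlogε.le hk1).trans hkε
  have hlogKL : Real.log K ≤ c * L / 2 := by
    have h1 : Real.log K ≤ 2 * c₂ * L * Real.log K :=
      le_mul_of_one_le_left hlogK (hk1.trans hkL)
    have h2 := mul_le_mul_of_nonneg_right hcK hL
    nlinarith
  rw [hpow, hinv, hKe, ← Real.exp_add, ← Real.exp_add, ← Real.exp_add]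
  refine Real.exp_le_exp.2 ?_
  have h1 : k * Real.log 17 ≤ 2 * c₂ * L * 3 :=
    mul_le_mul hkL h17 (Real.log_nonneg (by norm_num)) (by positivity)
  have h2 := mul_le_mul_of_nonneg_right hc hL
  linarith

/-- A bound `p` on the failure probability in a single direction controls the probability that a
standard Gaussian matrix is an almost isometric embedding of the Euclidean space, up to scaling,
for a permutation invariant norm comparable to the maximum norm. -/
theorem IsStdGaussianMatrix.one_sub_le_almost_isometric {Ω : Type*} [MeasurableSpace Ω]
    {μ : Measure Ω} [IsProbabilityMeasure μ] {n k : ℕ} (hk : 0 < k)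
    {G : Ω → Matrix (Fin n) (Fin k) ℝ} (hG : IsStdGaussianMatrix μ G)
    (N : Seminorm ℝ (Fin n → ℝ))
    (hN : ∀ (σ : Equiv.Perm (Fin n)) (x : Fin n → ℝ), N (x ∘ σ) = N x)
    {c₁ C₁ : ℝ} (hc₁ : 0 < c₁) (hcC : c₁ < C₁)
    (hNb : ∀ x : Fin n → ℝ, c₁ * ‖x‖ ≤ N x ∧ N x ≤ C₁ * ‖x‖) {ε : ℝ} (hε : 0 < ε)
    (hε1 : ε < 1) (hL : 5 ≤ ε * Real.log n) {p : ℝ}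
    (hp : 576 / (c₁ / (32 * C₁)) ^ 5 * (ε⁻¹) ^ 3 *
      Real.exp (-(c₁ / (32 * C₁) / 8 * (ε * Real.log n))) ≤ p) (hp1 : p < 1 / 2) {M : ℝ}
    (hM : IsMedian μ (fun ω => N ((G ω).mulVec (Pi.single ⟨0, hk⟩ 1))) M) :
    1 - (17 / ε) ^ k * p ≤ μ.real {ω | ∀ x : EuclideanSpace ℝ (Fin k),
      (1 - ε) * M * ‖x‖ ≤ N ((G ω).mulVec x.ofLp) ∧
      N ((G ω).mulVec x.ofLp) ≤ (1 + ε) * M * ‖x‖} := by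
  have hC₁ : 0 < C₁ := hc₁.trans hcC
  -- Chosen so that the oscillation `C₁ * (2 * δ)` equals `ε / 4` times the lower bound `c₁ * (s /
  -- 4)` for the median.
  set η := c₁ / (32 * C₁) with hηdef
  have hη : 0 < η := by positivity
  have hη1 : η ≤ 1 := by
    rw [hηdef, div_le_one (by positivity)]; linarith
  obtain ⟨a, m, ham, hbad⟩ := exists_interlaced_levels hη hη1 hε hε1 hL
  have hlog : 5 ≤ Real.log n := by
    have := mul_le_of_le_one_left (Real.log_natCast_nonneg n) hε1.le
    linarith
  set s := √(Real.log n)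
  have hs : 0 < s := Real.sqrt_pos.2 (by linarith)
  set δ := η * ε * s with hδdef
  have hδ : 0 < δ := by positivity
  let good : (Fin n → ℝ) → Prop := fun x => Interlaced a δ m x ∧ Interlaced a δ m (-x)
  have hgood : ∀ {x y}, good x → good y → N x - N y ≤ C₁ * (2 * δ) := fun hx hy =>
    Interlaced.seminorm_sub_le N hN hC₁.le (fun x => (hNb x).2) hδ ham hx.1 hx.2 hy.1 hy.2
  have hfail : ∀ {x : Fin k → ℝ}, ∑ j, x j ^ 2 = 1 →
      μ.real {ω | ¬ good ((G ω).mulVec x)} ≤ p := fun hx => (hbad μ _ (hG.mulVec hx)).trans hp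
  have he : ∑ j, (Pi.single ⟨0, hk⟩ 1 : Fin k → ℝ) j ^ 2 = 1 := by
    simp [Pi.single_apply]
  have hMs : c₁ * (s / 4) ≤ M :=
    (hG.mulVec he).le_median hc₁ (fun x => (hNb x).1) hlog hM
  have hM0 : 0 ≤ M := le_trans (by positivity) hMs
  have hδM : C₁ * (2 * δ) ≤ ε / 4 * M := by
    have : C₁ * (2 * δ) = ε / 4 * (c₁ * (s / 4)) := by
      rw [hδdef, hηdef]; field_simp; ring
    rw [this]
    exact mul_le_mul_of_nonneg_left hMs (by positivity)
  obtain ⟨ω₁, hω₁, hω₁M⟩ := hM.exists_notMem_le ((hfail he).trans_lt hp1)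
  obtain ⟨ω₂, hω₂, hω₂M⟩ := hM.exists_notMem_ge ((hfail he).trans_lt hp1)
  have hconc : ∀ x, good x → |N x - M| ≤ ε / 4 * M := fun x hx => by
    have h1 := hgood hx (not_not.1 hω₁)
    have h2 := hgood (not_not.1 hω₂) hx
    exact abs_le.2 ⟨by linarith, by linarith⟩
  obtain ⟨T, hT1, hTnet, hTcard⟩ := exists_sphere_net (EuclideanSpace ℝ (Fin k))
    (show 0 < ε / 8 by positivity)
  have hNcont : Continuous N := by
    refine Seminorm.continuous_of_le (q := C₁.toNNReal • normSeminorm ℝ (Fin n → ℝ))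
      (continuous_const.mul continuous_norm) fun x => ?_
    simpa [NNReal.smul_def, hC₁.le] using (hNb x).2
  have hsub : {ω | ∀ x : EuclideanSpace ℝ (Fin k),
      (1 - ε) * M * ‖x‖ ≤ N ((G ω).mulVec x.ofLp) ∧
      N ((G ω).mulVec x.ofLp) ≤ (1 + ε) * M * ‖x‖}ᶜ ⊆
      ⋃ x ∈ T, {ω | ¬ good ((G ω).mulVec x.ofLp)} := by
    intro ω hω
    by_contra hnot
    simp only [Set.mem_iUnion, Set.mem_ofPred_eq, not_exists, not_not] at hnot
    apply hω
    let A : EuclideanSpace ℝ (Fin k) →ₗ[ℝ] (Fin n → ℝ) :=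
      (G ω).mulVecLin ∘ₗ (WithLp.linearEquiv 2 ℝ (Fin k → ℝ)).toLinearMap
    exact Seminorm.almost_isometric_of_net (N.comp A)
      (hNcont.comp (LinearMap.continuous_of_finiteDimensional A)) hε hε1 hM0 T hTnet
      fun x hx => hconc _ (hnot x hx)
  have hunit : ∀ x ∈ T, ∑ j, x.ofLp j ^ 2 = 1 := fun x hx => by
    rw [← EuclideanSpace.real_norm_sq_eq, hT1 x hx, one_pow]
  have hunion : μ.real (⋃ x ∈ T, {ω | ¬ good ((G ω).mulVec x.ofLp)}) ≤ (17 / ε) ^ k * p := by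
    refine (measureReal_biUnion_finset_le _ _).trans ?_
    refine (Finset.sum_le_card_nsmul _ _ _ fun x hx => hfail (hunit x hx)).trans ?_
    rw [nsmul_eq_mul]
    refine mul_le_mul_of_nonneg_right (hTcard.trans ?_) (measureReal_nonneg.trans (hfail he))
    rw [finrank_euclideanSpace_fin]
    refine pow_le_pow_left₀ (by positivity) ?_ k
    rw [le_div_iff₀ hε]
    field_simp
    linarith
  linarith [one_sub_le_measureReal_of_compl_subset (μ := μ) hsub]

/- `‖x‖` is the maximum norm for `x : Fin n → ℝ` and the Euclidean norm for
`x : EuclideanSpace ℝ (Fin k)`. The seminorm `N` is a norm because `c₁ * ‖x‖ ≤ N x`, `0 < c₁`. -/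
theorem theorem2 :
    ∃ C : ℝ, 0 < C ∧
      ∀ c₁ C₁ : ℝ, 0 < c₁ → c₁ < C₁ →
        ∃ c₂ : ℝ, 0 < c₂ ∧
          ∀ (n : ℕ) (N : Seminorm ℝ (Fin n → ℝ)),
            (∀ (σ : Equiv.Perm (Fin n)) (x : Fin n → ℝ), N (x ∘ σ) = N x) →
            (∀ x : Fin n → ℝ, c₁ * ‖x‖ ≤ N x ∧ N x ≤ C₁ * ‖x‖) →
            ∀ ε : ℝ, 0 < ε → ε < 1 →
              ∀ (k : ℕ) (hk : 0 < k),
                (k : ℝ) ≤ c₂ * ε * (Real.log ε⁻¹)⁻¹ * Real.log n →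
                (k : ℝ) ≤ c₂ * Real.log n →
                ∀ {Ω : Type*} [MeasurableSpace Ω] (μ : Measure Ω) [IsProbabilityMeasure μ]
                  (G : Ω → Matrix (Fin n) (Fin k) ℝ), IsStdGaussianMatrix μ G →
                  ∀ M : ℝ,
                    IsMedian μ (fun ω => N ((G ω).mulVec (Pi.single ⟨0, hk⟩ 1))) M →
                    1 - C * (n : ℝ) ^ (-(c₂ * ε)) ≤
                      μ.real {ω | ∀ x : EuclideanSpace ℝ (Fin k),
                        (1 - ε) * M * ‖x‖ ≤ N ((G ω).mulVec x.ofLp) ∧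
                        N ((G ω).mulVec x.ofLp) ≤ (1 + ε) * M * ‖x‖} := by
  refine ⟨1, one_pos, fun c₁ C₁ hc₁ hcC => ?_⟩
  have hC₁ : 0 < C₁ := hc₁.trans hcC
  set η := c₁ / (32 * C₁) with hηdef
  have hη : 0 < η := by positivity
  have hη1 : η ≤ 1 := by
    rw [hηdef, div_le_one (by positivity)]; linarith
  set K := 576 / η ^ 5 with hKdef
  have hK : 1 ≤ K := by
    rw [hKdef, one_le_div (by positivity)]
    linarith [pow_le_one₀ hη.le hη1 (n := 5)]
  have hlogK : 0 ≤ Real.log K := Real.log_nonneg hK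
  -- Small enough for both conditions relating `c₂` to `c = η / 8` in `net_card_mul_failure_le`.
  set c₂ := η / 8 / (22 * (1 + Real.log K)) with hc₂def
  have hc₂ : 0 < c₂ := by positivity
  have hc₂η : c₂ * (22 * (1 + Real.log K)) = η / 8 := by rw [hc₂def]; field_simp
  have hcK0 : 0 ≤ c₂ * Real.log K := by positivity
  refine ⟨c₂, hc₂, fun n N hN hNb ε hε hε1 k hk hk1 hk2 Ω _ μ _ G hG M hM => ?_⟩
  have hkpos : (1 : ℝ) ≤ k := by exact_mod_cast hk
  have hlogn : 0 < Real.log n := by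
    by_contra! h
    nlinarith
  have hn0 : (0 : ℝ) < n := by
    rcases Nat.eq_zero_or_pos n with rfl | h
    · simp at hlogn
    · exact_mod_cast h
  have hlogε : 0 < Real.log ε⁻¹ := Real.log_pos (one_lt_inv_iff₀.2 ⟨hε, hε1⟩)
  set L := ε * Real.log n with hLdef
  have hkε : k * Real.log ε⁻¹ ≤ c₂ * L := by
    calc k * Real.log ε⁻¹ ≤ c₂ * ε * (Real.log ε⁻¹)⁻¹ * Real.log n * Real.log ε⁻¹ :=
          mul_le_mul_of_nonneg_right hk1 hlogε.le
      _ = c₂ * L * ((Real.log ε⁻¹)⁻¹ * Real.log ε⁻¹) := by rw [hLdef]; ring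
      _ = c₂ * L := by rw [inv_mul_cancel₀ hlogε.ne', mul_one]
  -- For `ε ≤ 1 / 2` this follows from `log ε⁻¹ ≥ log 2 > 1 / 2`; for larger `ε`, from `log n ≤ 2 *
  -- L` and the second condition on `k`.
  have hkL : (k : ℝ) ≤ 2 * c₂ * L := by
    rcases le_total ε (1 / 2) with h | h
    · have hlog2 : 1 / 2 ≤ Real.log ε⁻¹ := by
        have : Real.log 2 ≤ Real.log ε⁻¹ := Real.log_le_log two_pos (by
          rw [le_inv_comm₀ two_pos hε]; linarith)
        linarith [Real.log_two_gt_d9]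
      nlinarith
    · have : c₂ * Real.log n ≤ c₂ * (2 * L) :=
        mul_le_mul_of_nonneg_left (by rw [hLdef]; nlinarith) hc₂.le
      linarith
  -- Since `1 ≤ k ≤ 2 * c₂ * L` and `c₂ ≤ 1 / 10`, the mere existence of `k` makes `n` large.
  have hL : 5 ≤ L := by
    have : c₂ ≤ 1 / 10 := by nlinarith
    by_contra! h
    nlinarith
  have htotal := net_card_mul_failure_le hk hε hε1 hK hc₂ (c := η / 8) (by linarith)
    (by linarith) hkL hkε
  set p := K * (ε⁻¹) ^ 3 * Real.exp (-(η / 8 * L)) with hpdef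
  have hp0 : 0 ≤ p := by positivity
  -- The total bound gives `17 * p ≤ (17 / ε) ^ k * p ≤ 1`.
  have hp1 : p < 1 / 2 := by
    have h17 : 17 ≤ (17 / ε) ^ k := by
      have h1 : 17 ≤ 17 / ε := by rw [le_div_iff₀ hε]; linarith
      exact h1.trans (le_self_pow₀ (by linarith) hk.ne')
    have h1 := mul_le_mul_of_nonneg_right h17 hp0
    have h2 : Real.exp (-(c₂ * L)) ≤ 1 := Real.exp_le_one_iff.2 (by nlinarith)
    linarith
  have hmain := hG.one_sub_le_almost_isometric hk N hN hc₁ hcC hNb hε hε1 hL le_rfl hp1 hM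
  refine le_trans ?_ hmain
  rw [one_mul, Real.rpow_def_of_pos hn0,
    show Real.log n * -(c₂ * ε) = -(c₂ * L) by rw [hLdef]; ring]
  linarith
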